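/- Let $N\ge 1$ be an integer, let $k$ be a commutative ring and let $\mathcal C$ be a small EI category, i.e. a small category in which every endomorphism is an isomorphism. For objects $c,d$ let $k\mathcal C(c,d)$ be the free $k$-module on the set $\mathcal C(c,d)$ of morphisms $c\to d$, and let $R_c=k\mathcal C(c,c)$, which is the group ring $kG_c$ of $G_c=\mathcal C(c,c)$; thus $k\mathcal C(c,d)$ is an $(R_d,R_c)$-bimodule. Write $[c]\le[d]$ if $\mathcal C(c,d)\neq\emptyset$; this is a partial order on the isomorphism classes of objects, and $c<d$ means $[c]\le[d]$ and $[c]\ne[d]$. A morphism is unfactorisable if it is not invertible and is not a composition of two non-invertible morphisms. A module $L$ is an $m$-th kernel ($m\geq 1$) if there is an exact sequence $0\to L\to P_m\to\dots\to P_1$ with all $P_i$ projective; every module is a $0$-th kernel. Assume: (FFP) every non-invertible morphism of $\mathcal C$ is a composition of finitely many unfactorisable morphisms; (UFP) whenever two chains $x=x_0\xrightarrow{\alpha_1}x_1\to\dots\xrightarrow{\alpha_n}x_n=y$ and $x=x_0'\xrightarrow{\alpha_1'}x_1'\to\dots\xrightarrow{\alpha'_{n'}}x'_{n'}=y$ of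 unfactorisable morphisms have the same composition, then $n=n'$ and there are isomorphisms $h_i\colon x_i\to x_i'$ $(0\le i\le n)$ with $h_0=\mathrm{id}_x$, $h_n=\mathrm{id}_y$ and $\alpha_i'h_{i-1}=h_i\alpha_i$ for $1\le i\le n$; (gl) the left global dimension of $kG_c$ is at most $N$ for every object $c$; $(\mathrm A_N)$ for all $c<d$ and every left $R_c$-module $L$ that is an $(N-1)$-st kernel, $\mathrm{Tor}_1^{R_c}(k\mathcal C(c,d),L)=0$; $(\mathrm B_N)$ for all $c<d$ and every short exact sequence $0\to Q\to P\to L\to 0$ of left $R_c$-modules with $Q,P$ projective and $L$ an $(N-1)$-st kernel, the induced right exact sequence $k\mathcal C(c,d)\otimes_{R_c}Q\to k\mathcal C(c,d)\otimes_{R_c}P\to k\mathcal C(c,d)\otimes_{R_c}L\to 0$ of left $R_d$-modules splits, i.e. its second map has an $R_d$-linear section; (BP) for all $c<d$, $k\mathcal C(c,d)$ is projective as a left $R_d$-module; and that there is no left-infinite chain, i.e. no sequence $(x_i)_{i\ge0}$ of objects with $x_{i+1}<x_i$ for all $i$. Then every projective left $k\mathcal C$-module $M$ (a projective object in the category of functors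 from $\mathcal C$ to $k$-modules) is isomorphic to a direct sum $\bigoplus_{c\in\mathrm{Ob}(\mathcal C)}k\mathcal C\otimes_{R_c}P_c$ with each $P_c$ a projective left $R_c$-module, where $k\mathcal C\otimes_{R_c}P_c$ denotes the functor $d\mapsto k\mathcal C(c,d)\otimes_{R_c}P_c$. -/

import Mathlib

open CategoryTheory CategoryTheory.Limits
open scoped TensorProduct

universe u

noncomputable section

/-! ### Discrete EI categories and factorisation of morphisms -/

section EI

variable {C : Type u} [SmallCategory C]

/-- An EI category: every endomorphism is an isomorphism. -/
def IsEI (C : Type u) [SmallCategory C] : Prop :=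
  ∀ (c : C) (f : c ⟶ c), IsIso f

/-- A non-invertible morphism which is not a composite of two non-invertible morphisms. -/
def Unfactorisable {x y : C} (f : x ⟶ y) : Prop :=
  ¬ IsIso f ∧ ∀ (z : C) (g : x ⟶ z) (h : z ⟶ y), g ≫ h = f → IsIso g ∨ IsIso h

/-- A finite chain `x = x₀ ⟶ x₁ ⟶ ⋯ ⟶ xₙ = y` of unfactorisable morphisms. -/
inductive UChain : C → C → Type u
  | nil (x : C) : UChain x x
  | cons {x z y : C} (α : x ⟶ z) (hα : Unfactorisable α) (γ : UChain z y) : UChain x y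

/-- The composition of a chain of unfactorisable morphisms. -/
def UChain.comp : {x y : C} → UChain x y → (x ⟶ y)
  | _, _, .nil x => 𝟙 x
  | _, _, .cons α _ γ => α ≫ γ.comp

/-- `Ladder h γ γ'`: the chains `γ`, `γ'` have the same length, and there are isomorphisms between
their successive objects, the first being `h` and the last the identity of the common end point,
which make the ladder diagram commute. -/
inductive Ladder : {x x' y : C} → (x ≅ x') → UChain x y → UChain x' y → Prop
  | nil (x : C) : Ladder (Iso.refl x) (.nil x) (.nil x)
  | cons {x x' z z' y : C} (h : x ≅ x') (h₁ : z ≅ z')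
      (α : x ⟶ z) (hα : Unfactorisable α) (γ : UChain z y)
      (α' : x' ⟶ z') (hα' : Unfactorisable α') (γ' : UChain z' y)
      (comm : h.hom ≫ α' = α ≫ h₁.hom) (rest : Ladder h₁ γ γ') :
      Ladder h (.cons α hα γ) (.cons α' hα' γ')

/-- The finite factorisation property: every non-invertible morphism is a composition of finitely
many unfactorisable morphisms. -/
def FFP (C : Type u) [SmallCategory C] : Prop :=
  ∀ (x y : C) (f : x ⟶ y), ¬ IsIso f → ∃ γ : UChain x y, γ.comp = f

/-- The unique factorisation property: two chains of unfactorisables from `x` to `y` with the same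
composition are connected by a commutative ladder of isomorphisms which starts with `𝟙 x` and ends
with `𝟙 y` (in particular they have the same length). -/
def UFP (C : Type u) [SmallCategory C] : Prop :=
  ∀ (x y : C) (γ γ' : UChain x y), γ.comp = γ'.comp → Ladder (Iso.refl x) γ γ'

/-- The relation `[c] < [d]` of the object poset, whose elements are the isomorphism classes of
objects, with `[c] ≤ [d]` iff there is a morphism from `c` to `d`. -/
def ObjLT (c d : C) : Prop :=
  Nonempty (c ⟶ d) ∧ ¬ Nonempty (c ≅ d)

/-- The object poset has no left-infinite chain `⋯ < x₂ < x₁ < x₀`. -/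
def NoLeftInfiniteChains (C : Type u) [SmallCategory C] : Prop :=
  ¬ ∃ x : ℕ → C, ∀ i, ObjLT (x (i + 1)) (x i)

end EI

/-! ### The tensor product of a right and a left module over a noncommutative ring -/

section BalTensor

variable (R : Type u) [Ring R] (M : Type u) [AddCommGroup M] [Module Rᵐᵒᵖ M]
  (P : Type u) [AddCommGroup P] [Module R P]

/-- The subgroup of `M ⊗[ℤ] P` generated by the elements `(m r) ⊗ p - m ⊗ (r p)`. -/
def balRel : AddSubgroup (M ⊗[ℤ] P) :=
  AddSubgroup.closure
    {t | ∃ (m : M) (r : R) (p : P), t = (MulOpposite.op r • m) ⊗ₜ[ℤ] p - m ⊗ₜ[ℤ] (r • p)}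

/-- The tensor product `M ⊗_R P` of a right `R`-module `M` and a left `R`-module `P`. -/
def BalTensor : Type u := (M ⊗[ℤ] P) ⧸ balRel R M P

instance : AddCommGroup (BalTensor R M P) :=
  inferInstanceAs (AddCommGroup ((M ⊗[ℤ] P) ⧸ balRel R M P))

namespace BalTensor

variable (S : Type u) [Ring S] [Module S M] [SMulCommClass S Rᵐᵒᵖ M]

/-- The same subgroup, as a submodule for a ring `S` acting on `M` from the left. -/
def relSubmodule : Submodule S (M ⊗[ℤ] P) where
  __ := balRel R M P
  smul_mem' s t ht := by
    change t ∈ balRel R M P at ht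
    change s • t ∈ balRel R M P
    refine AddSubgroup.closure_induction (p := fun t _ => s • t ∈ balRel R M P)
      ?_ ?_ ?_ ?_ ht
    · rintro _ ⟨m, r, p, rfl⟩
      refine AddSubgroup.subset_closure ⟨s • m, r, p, ?_⟩
      rw [smul_sub, TensorProduct.smul_tmul', TensorProduct.smul_tmul', smul_comm]
    · rw [smul_zero]; exact zero_mem _
    · intro a b _ _ ha hb
      rw [smul_add]; exact add_mem ha hb
    · intro a _ ha
      rw [smul_neg]; exact neg_mem ha

/-- If `M` is an `(S, R)`-bimodule, then `M ⊗_R P` is a left `S`-module. -/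
instance : Module S (BalTensor R M P) :=
  inferInstanceAs (Module S ((M ⊗[ℤ] P) ⧸ relSubmodule R M P S))

variable {M P}

/-- The element `m ⊗ p` of `M ⊗_R P`. -/
def tmul (m : M) (p : P) : BalTensor R M P :=
  QuotientAddGroup.mk (s := balRel R M P) (m ⊗ₜ[ℤ] p)

variable {R S}

lemma ind {p : BalTensor R M P → Prop} (h0 : p 0) (ht : ∀ m x, p (tmul R m x))
    (ha : ∀ a b, p a → p b → p (a + b)) (t : BalTensor R M P) : p t := by
  obtain ⟨t, rfl⟩ := QuotientAddGroup.mk_surjective (s := balRel R M P) t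
  induction t using TensorProduct.induction_on with
  | zero => exact h0
  | tmul m x => exact ht m x
  | add a b hx hy => exact ha _ _ hx hy

lemma smul_tmul' (s : S) (m : M) (p : P) : s • tmul R m p = tmul R (s • m) p := rfl

/-- Additive maps `a : M → M'` and `b : P → P'`, compatible with the actions of `R`, induce an
additive map `m ⊗ p ↦ a m ⊗ b p`. -/
def map {M' : Type u} [AddCommGroup M'] [Module Rᵐᵒᵖ M'] {P' : Type u} [AddCommGroup P']
    [Module R P'] (a : M →ₗ[Rᵐᵒᵖ] M') (b : P →ₗ[R] P') : BalTensor R M P →+ BalTensor R M' P' :=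
  QuotientAddGroup.map (balRel R M P) (balRel R M' P')
    (TensorProduct.map a.toAddMonoidHom.toIntLinearMap b.toAddMonoidHom.toIntLinearMap).toAddMonoidHom
    (by
      refine (AddSubgroup.closure_le _).2 ?_
      rintro _ ⟨m, r, p, rfl⟩
      refine AddSubgroup.subset_closure ⟨a m, r, b p, ?_⟩
      simp)

lemma map_tmul {M' : Type u} [AddCommGroup M'] [Module Rᵐᵒᵖ M'] {P' : Type u} [AddCommGroup P']
    [Module R P'] (a : M →ₗ[Rᵐᵒᵖ] M') (b : P →ₗ[R] P') (m : M) (p : P) :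
    map a b (tmul R m p) = tmul R (a m) (b p) := rfl

variable (M S) in
/-- The `S`-linear map `id ⊗ b : M ⊗_R P → M ⊗_R P'` for an `(S, R)`-bimodule `M`. -/
def lTensor {P' : Type u} [AddCommGroup P'] [Module R P'] (b : P →ₗ[R] P') :
    BalTensor R M P →ₗ[S] BalTensor R M P' where
  __ := map (LinearMap.id : M →ₗ[Rᵐᵒᵖ] M) b
  map_smul' s t := by
    change map LinearMap.id b (s • t) = s • map LinearMap.id b t
    induction t using ind with
    | h0 => simp
    | ht m x => rfl
    | ha x y hx hy => rw [smul_add, map_add, hx, hy, map_add, smul_add]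

variable (S P) in
/-- The `S`-linear map `a ⊗ id : M ⊗_R P → M' ⊗_R P` for `a` a map of `(S, R)`-bimodules. -/
def rTensor {M' : Type u} [AddCommGroup M'] [Module Rᵐᵒᵖ M'] [Module S M']
    [SMulCommClass S Rᵐᵒᵖ M'] (a : M →ₗ[Rᵐᵒᵖ] M') (ha : ∀ (s : S) (m : M), a (s • m) = s • a m) :
    BalTensor R M P →ₗ[S] BalTensor R M' P where
  __ := map a (LinearMap.id : P →ₗ[R] P)
  map_smul' s t := by
    change map a LinearMap.id (s • t) = s • map a LinearMap.id t
    induction t using ind with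
    | h0 => simp
    | ht m x => rw [smul_tmul', map_tmul, map_tmul, smul_tmul', ha]
    | ha x y hx hy => rw [smul_add, map_add, hx, hy, map_add, smul_add]

end BalTensor

/-- The functor `M ⊗_R -` from left `R`-modules to abelian groups. -/
def tensorFunctor : ModuleCat.{u} R ⥤ AddCommGrpCat.{u} where
  obj P := AddCommGrpCat.of (BalTensor R M P)
  map f := AddCommGrpCat.ofHom (BalTensor.map LinearMap.id f.hom)
  map_id P := by
    ext t
    induction t using BalTensor.ind with
    | h0 => simp
    | ht m x => rfl
    | ha x y hx hy => rw [map_add, hx, hy, map_add]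
  map_comp f g := by
    ext t
    induction t using BalTensor.ind with
    | h0 => simp
    | ht m x => rfl
    | ha x y hx hy => rw [map_add, hx, hy, map_add]

instance : (tensorFunctor R M).Additive where
  map_add {P P' f g} := by
    apply AddCommGrpCat.hom_ext
    apply AddMonoidHom.ext
    intro (t : BalTensor R M P)
    change BalTensor.map LinearMap.id (f + g).hom t =
      BalTensor.map LinearMap.id f.hom t + BalTensor.map LinearMap.id g.hom t
    induction t using BalTensor.ind with
    | h0 => simp
    | ht m x =>
      change BalTensor.tmul R m (f.hom x + g.hom x) =
        BalTensor.tmul R m (f.hom x) + BalTensor.tmul R m (g.hom x)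
      unfold BalTensor.tmul
      rw [TensorProduct.tmul_add]
      rfl
    | ha x y hx hy => rw [map_add, map_add, map_add, hx, hy]; abel

/-- The abelian group `Tor_1^R(M, P)`: the first left derived functor of `M ⊗_R -` at `P`. -/
def TorOne (P : ModuleCat.{u} R) : AddCommGrpCat.{u} :=
  ((tensorFunctor R M).leftDerived 1).obj P

end BalTensor

/-! ### `N`-th kernels and global dimension -/

/-- `K` is an `N`-th kernel: there are projectives `P₁, …, P_N` and an exact sequence
`0 ⟶ K ⟶ P_N ⟶ ⋯ ⟶ P₁`; every object is a `0`-th kernel. (Here `P = P_N` and `L` is the image of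
`P_N ⟶ P_{N-1}`, respectively `P₁ / K` if `N = 1`.) -/
def IsNthKernel {A : Type (u + 1)} [Category.{u} A] [HasZeroMorphisms A] : ℕ → A → Prop
  | 0, _ => True
  | n + 1, K => ∃ (P L : A) (f : K ⟶ P) (g : P ⟶ L) (w : f ≫ g = 0),
      Projective P ∧ (ShortComplex.mk f g w).ShortExact ∧ IsNthKernel n L

/-- The left global dimension of the ring `R` is at most `N`. -/
def GlobalDimensionLE (R : Type u) [Ring R] (N : ℕ) : Prop :=
  ∀ M : ModuleCat.{u} R, HasProjectiveDimensionLE M N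

/-! ### Bimodules of morphisms and induced modules in a `k`-linear category -/

section Linear

variable {D : Type u} [SmallCategory D] [Preadditive D]

instance (c d : D) : SMulCommClass (End d) (End c)ᵐᵒᵖ (c ⟶ d) where
  smul_comm s r f := by
    change (r.unop ≫ f) ≫ s = r.unop ≫ (f ≫ s)
    exact Category.assoc _ _ _

instance (k : Type u) [CommRing k] [Linear k D] (c d : D) :
    SMulCommClass k (End c)ᵐᵒᵖ (c ⟶ d) where
  smul_comm s r f := by
    change s • (r.unop ≫ f) = r.unop ≫ (s • f)
    exact (Linear.comp_smul _ _ _ r.unop s f).symm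

/-- Composition with `f : d ⟶ d'` as a map of right `End c`-modules. -/
def postcomp (c : D) {d d' : D} (f : d ⟶ d') : (c ⟶ d) →ₗ[(End c)ᵐᵒᵖ] (c ⟶ d') where
  toFun g := g ≫ f
  map_add' _ _ := Preadditive.add_comp _ _ _ _ _ _
  map_smul' _ _ := Category.assoc _ _ _

/-- The induced module `D ⊗_{R_c} P`, with `R_c = End c`, for a `k`-linear category `D` and a left
`R_c`-module `P`: the functor `d ↦ D(c, d) ⊗_{R_c} P`. -/
def inducedFunctorOfLinear (k : Type u) [CommRing k] [Linear k D] (c : D)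
    (P : ModuleCat.{u} (End c)) : D ⥤ ModuleCat.{u} k where
  obj d := ModuleCat.of k (BalTensor (End c) (c ⟶ d) P)
  map f := ModuleCat.ofHom (BalTensor.rTensor P k (postcomp c f)
    (fun s g => Linear.smul_comp _ _ _ s g f))
  map_id d := by
    ext t
    induction t using BalTensor.ind with
    | h0 => simp
    | ht m x =>
      change BalTensor.tmul (End c) (m ≫ 𝟙 d) x = BalTensor.tmul (End c) m x
      rw [Category.comp_id]
    | ha x y hx hy => rw [map_add, hx, hy, map_add]
  map_comp {d d' d''} f g := by
    ext t
    induction t using BalTensor.ind with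
    | h0 => simp
    | ht m x =>
      change BalTensor.tmul (End c) (m ≫ f ≫ g) x = BalTensor.tmul (End c) ((m ≫ f) ≫ g) x
      rw [Category.assoc]
    | ha x y hx hy => rw [map_add, hx, hy, map_add]

end Linear

/-! ### The `k`-linearisation of a discrete category -/

section Linearisation

variable (k : Type u) [CommRing k] {C : Type u} [SmallCategory C]

/-- The `(R_d, R_c)`-bimodule `kC(c, d)`, the free `k`-module on the morphisms from `c` to `d`. -/
abbrev LinHom (c d : C) : Type u := Free.of k c ⟶ Free.of k d

/-- The endomorphism algebra `R_c = kC(c, c)`, that is, the group ring `kG_c`. -/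
abbrev EndAlg (c : C) : Type u := End (Free.of k c)

/-- `R_c` is the group ring of `G_c = C(c, c)`. -/
def groupRingEquivEndAlg (c : C) : MonoidAlgebra k (End c) ≃+* EndAlg k c where
  toFun f := f.coeff
  invFun f := MonoidAlgebra.ofCoeff (f : (c ⟶ c) →₀ k)
  left_inv _ := rfl
  right_inv _ := rfl
  map_add' _ _ := rfl
  map_mul' f g := by
    let φ : MonoidAlgebra k (End c) →+ EndAlg k c := ⟨⟨fun f => f.coeff, rfl⟩, fun _ _ => rfl⟩
    change φ (f * g) = φ f * φ g
    induction f using MonoidAlgebra.induction_linear with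
    | zero => rw [zero_mul, map_zero, zero_mul]
    | add x y hx hy => rw [add_mul, map_add, hx, hy, map_add, add_mul]
    | single a r =>
      induction g using MonoidAlgebra.induction_linear with
      | zero => rw [mul_zero, map_zero, mul_zero]
      | add x y hx hy => rw [mul_add, map_add, hx, hy, map_add, mul_add]
      | single b s =>
        rw [MonoidAlgebra.single_mul_single, mul_comm r s]
        exact (Free.single_comp_single k C b a s r).symm

/-- The induced left `kC`-module `kC ⊗_{R_c} P`, `d ↦ kC(c, d) ⊗_{R_c} P`, as a functor from `C` to
`k`-modules. -/
def inducedModule (c : C) (P : ModuleCat.{u} (EndAlg k c)) : C ⥤ ModuleCat.{u} k :=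
  Free.embedding k C ⋙ inducedFunctorOfLinear k (Free.of k c) P

variable (C)

/-- Condition `(A_N)`: for all `c < d` and every `(N-1)`-st kernel `L` in the category of left
`R_c`-modules, `Tor_1^{R_c}(kC(c, d), L) = 0`. -/
def ConditionA (N : ℕ) : Prop :=
  ∀ c d : C, ObjLT c d → ∀ L : ModuleCat.{u} (EndAlg k c), IsNthKernel (N - 1) L →
    IsZero (TorOne (EndAlg k c) (LinHom k c d) L)

/-- Condition `(B_N)`: for all `c < d` and every short exact sequence `0 ⟶ Q ⟶ P ⟶ L ⟶ 0` of left
`R_c`-modules with `Q`, `P` projective and `L` an `(N-1)`-st kernel, the induced right exact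
sequence obtained by applying `kC(c, d) ⊗_{R_c} -` splits as a sequence of left `R_d`-modules. -/
def ConditionB (N : ℕ) : Prop :=
  ∀ c d : C, ObjLT c d →
    ∀ (Q P L : ModuleCat.{u} (EndAlg k c)) (f : Q ⟶ P) (g : P ⟶ L) (w : f ≫ g = 0),
      Projective Q → Projective P → IsNthKernel (N - 1) L → (ShortComplex.mk f g w).ShortExact →
      ∃ s : BalTensor (EndAlg k c) (LinHom k c d) L →ₗ[EndAlg k d]
          BalTensor (EndAlg k c) (LinHom k c d) P,
        (BalTensor.lTensor (LinHom k c d) (EndAlg k d) g.hom).comp s = LinearMap.id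

/-- Condition `(BP)`: for all `c < d`, `kC(c, d)` is projective as a left `R_d`-module. -/
def ConditionBP : Prop :=
  ∀ c d : C, ObjLT c d → Module.Projective (EndAlg k d) (LinHom k c d)

end Linearisation

end

/-! The argument is a Nakayama-type one. For a left `kC`-module `M`, the images in `M(c)` of the
non-isomorphisms ending at `c` span an `R_c`-submodule, the singular part; let `M(c)/sing` be the
quotient. A noninvertible morphism into `c` starts strictly below `c`, so well-founded induction
along the object order shows that a map of modules which is surjective modulo singular parts is
surjective (`IsSkeletal.surjective_app`).

The functor `M ↦ M(c)/sing` is left adjoint to extension by zero from `R_c`-modules to `kC`-modules.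
Extension by zero preserves epimorphisms, hence `M(c)/sing` is projective when `M` is
(`projective_quotient_singularPart`). `R_c`-linear sections of the quotient maps then induce `φ : ⨁
kC ⊗ M(c)/sing ⟶ M`, which is epi by the Nakayama argument and has a section `s` because `M` is
projective. The regular quotient of the induced sum at `c` is generated by the elements `id ⊗ p`, on
which `φ` is the identity modulo singular parts. So `ker φ` is singular, `s` is surjective modulo
singular parts, hence epi; being split mono, it is an isomorphism.

Isomorphic objects must not contribute twice to the sum. A set `T` of representatives is fixed, and
the singular part is declared to be everything outside `T`, so that the summand there is zero. -/

noncomputable section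

/-! ### Values of a `kC`-module as modules over the endomorphism rings. -/

section EndModule

variable (k : Type u) [CommRing k] {C : Type u} [SmallCategory C]

/-- The basis element of `kC(c, d)` given by a morphism. -/
def LinHom.of {c d : C} (f : c ⟶ d) : LinHom k c d := (Free.embedding k C).map f

/-- The basis element of `R_c` given by an endomorphism. -/
def EndAlg.of {c : C} (g : c ⟶ c) : EndAlg k c := LinHom.of k g

variable {k}

lemma LinHom.of_id (c : C) : LinHom.of k (𝟙 c) = 𝟙 (Free.of k c) := rfl

lemma LinHom.of_comp {c d e : C} (f : c ⟶ d) (g : d ⟶ e) :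
    LinHom.of k (f ≫ g) = LinHom.of k f ≫ LinHom.of k g :=
  (Free.embedding k C).map_comp f g

lemma LinHom.induction {c d : C} {p : LinHom k c d → Prop} (h0 : p 0)
    (ha : ∀ f g, p f → p g → p (f + g)) (hs : ∀ (a : k) (f : c ⟶ d), p (a • LinHom.of k f))
    (f : LinHom k c d) : p f := by
  refine Finsupp.induction_linear (motive := p) f h0 (fun f g => ha f g) fun g a => ?_
  have := hs a g
  exact (show Finsupp.single g a = a • LinHom.of k g from (Finsupp.smul_single_one g a).symm) ▸ this

/-- Multiplication in `End` reverses the order of `≫`; this is why values of covariant functors are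
left modules. -/
lemma EndAlg.of_comp {c : C} (f g : c ⟶ c) :
    EndAlg.of k (f ≫ g) = EndAlg.of k g * EndAlg.of k f := LinHom.of_comp f g

lemma EndAlg.induction {c : C} {p : EndAlg k c → Prop} (h0 : p 0)
    (ha : ∀ f g, p f → p g → p (f + g)) (hs : ∀ (a : k) (f : c ⟶ c), p (a • EndAlg.of k f))
    (f : EndAlg k c) : p f :=
  LinHom.induction h0 ha hs f

variable (M : C ⥤ ModuleCat.{u} k)

/-- The action of `kC(c, d)` on a left `kC`-module `M`. -/
def linAct {c d : C} : LinHom k c d →ₗ[k] M.obj c →ₗ[k] M.obj d :=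
  Finsupp.linearCombination k fun g : c ⟶ d => (M.map g).hom

lemma linAct_of {c d : C} (f : c ⟶ d) (x : M.obj c) :
    linAct M (LinHom.of k f) x = M.map f x := by
  have h : linAct M (LinHom.of k f) = (M.map f).hom :=
    (Finsupp.linearCombination_single k (1 : k) f).trans (one_smul k _)
  rw [h]

lemma linAct_id (c : C) (x : M.obj c) : linAct M (𝟙 (Free.of k c)) x = x := by
  rw [← LinHom.of_id, linAct_of, M.map_id]; rfl

lemma linAct_comp {c d e : C} (f : LinHom k c d) (g : LinHom k d e) (x : M.obj c) :
    linAct M (f ≫ g) x = linAct M g (linAct M f x) := by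
  induction f using LinHom.induction with
  | h0 => simp
  | ha f f' hf hf' => simp only [Preadditive.add_comp, map_add, LinearMap.add_apply, hf, hf']
  | hs a f =>
    induction g using LinHom.induction with
    | h0 => simp
    | ha g g' hg hg' => simp only [Preadditive.comp_add, map_add, LinearMap.add_apply, hg, hg']
    | hs b g =>
      simp only [Linear.smul_comp, Linear.comp_smul, ← LinHom.of_comp, map_smul,
        LinearMap.smul_apply, linAct_of, M.map_comp, ModuleCat.comp_apply]
      exact smul_comm b a _

lemma linAct_naturality {M M' : C ⥤ ModuleCat.{u} k} (φ : M ⟶ M') {c d : C} (f : LinHom k c d)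
    (x : M.obj c) : φ.app d (linAct M f x) = linAct M' f (φ.app c x) := by
  induction f using LinHom.induction with
  | h0 => simp
  | ha f g hf hg => simp only [map_add, LinearMap.add_apply, hf, hg]
  | hs a f =>
    simp only [map_smul, LinearMap.smul_apply, linAct_of]
    congr 1
    exact NatTrans.naturality_apply φ f x

/-- The value at `c` of a left `kC`-module is a left `R_c`-module. -/
instance endModule (c : C) : Module (EndAlg k c) (M.obj c) where
  smul r x := linAct M r x
  one_smul x := linAct_id M c x
  mul_smul r s x := linAct_comp M s r x
  smul_zero r := map_zero (linAct M (c := c) (d := c) r)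
  smul_add r := map_add (linAct M (c := c) (d := c) r)
  add_smul r s x := by
    change linAct M (r + s) x = _
    rw [map_add]; rfl
  zero_smul x := by
    change linAct M 0 x = _
    rw [map_zero]; rfl

/-- The value at `c` of a map of left `kC`-modules is `R_c`-linear. -/
def appEnd {M M' : C ⥤ ModuleCat.{u} k} (φ : M ⟶ M') (c : C) :
    M.obj c →ₗ[EndAlg k c] M'.obj c where
  toFun := φ.app c
  map_add' := map_add (φ.app c).hom
  map_smul' r x := linAct_naturality φ r x

lemma endAlg_of_smul {c : C} (g : c ⟶ c) (x : M.obj c) : EndAlg.of k g • x = M.map g x :=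
  linAct_of M g x

/-- Allows `R_c`-linearity to be tested on `k` and on group elements separately. -/
instance (c : C) : IsScalarTower k (EndAlg k c) (M.obj c) where
  smul_assoc a r x := by
    change linAct M (a • r) x = a • linAct M r x
    rw [map_smul]; rfl

end EndModule

/-! ### Induced modules and their universal property. -/

section Induced

variable {k : Type u} [CommRing k] {C : Type u} [SmallCategory C]

namespace BalTensor

variable {R : Type u} [Ring R] {M : Type u} [AddCommGroup M] [Module Rᵐᵒᵖ M]
  {P : Type u} [AddCommGroup P] [Module R P]

lemma add_tmul (m m' : M) (p : P) : tmul R (m + m') p = tmul R m p + tmul R m' p := by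
  unfold tmul; rw [TensorProduct.add_tmul]; rfl

lemma zero_tmul (p : P) : tmul R (0 : M) p = 0 := by
  unfold tmul; rw [TensorProduct.zero_tmul]; rfl

lemma tmul_zero (m : M) : tmul R m (0 : P) = 0 := by
  unfold tmul; rw [TensorProduct.tmul_zero]; rfl

lemma tmul_add (m : M) (p p' : P) : tmul R m (p + p') = tmul R m p + tmul R m p' := by
  unfold tmul
  rw [TensorProduct.tmul_add]; rfl

lemma op_smul_tmul (m : M) (r : R) (p : P) :
    tmul R (MulOpposite.op r • m) p = tmul R m (r • p) := by
  refine (QuotientAddGroup.eq_iff_sub_mem (N := balRel R M P)).2 ?_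
  exact AddSubgroup.subset_closure ⟨m, r, p, rfl⟩

/-- A balanced biadditive map induces an additive map on `M ⊗_R P`. -/
def lift {A : Type u} [AddCommGroup A] (b : M →+ P →+ A)
    (hb : ∀ m (r : R) p, b (MulOpposite.op r • m) p = b m (r • p)) : BalTensor R M P →+ A :=
  QuotientAddGroup.lift (balRel R M P)
    (TensorProduct.liftAddHom b fun n m p => by simp)
    (by
      refine (AddSubgroup.closure_le _).2 ?_
      rintro _ ⟨m, r, p, rfl⟩
      simp [AddMonoidHom.mem_ker, hb])

end BalTensor

/-- The element `f ⊗ p` of `kC(c, d) ⊗_{R_c} P`. -/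
def inducedTmul {c d : C} (P : ModuleCat.{u} (EndAlg k c)) (f : LinHom k c d) (p : P) :
    (inducedModule k c P).obj d :=
  BalTensor.tmul (EndAlg k c) (M := LinHom k c d) f p

variable {c d e : C} (P : ModuleCat.{u} (EndAlg k c))

lemma inducedTmul_zero (p : P) : inducedTmul P (0 : LinHom k c d) p = 0 :=
  BalTensor.zero_tmul (R := EndAlg k c) (M := LinHom k c d) p

lemma inducedTmul_add (f g : LinHom k c d) (p : P) :
    inducedTmul P (f + g) p = inducedTmul P f p + inducedTmul P g p :=
  BalTensor.add_tmul (R := EndAlg k c) (M := LinHom k c d) f g p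

lemma inducedTmul_smul (r : EndAlg k c) (f : LinHom k c d) (p : P) :
    inducedTmul P f (r • p) = inducedTmul P (show LinHom k c d from r ≫ f) p :=
  (BalTensor.op_smul_tmul (R := EndAlg k c) (M := LinHom k c d) f r p).symm

lemma smul_inducedTmul (a : k) (f : LinHom k c d) (p : P) :
    a • inducedTmul P f p = inducedTmul P (a • f) p := rfl

lemma inducedModule_map_tmul (f : LinHom k c d) (g : d ⟶ e) (p : P) :
    (inducedModule k c P).map g (inducedTmul P f p) =
      inducedTmul P (show LinHom k c e from f ≫ LinHom.of k g) p := rfl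

/-- The element `id ⊗ p` of `kC(c, c) ⊗_{R_c} P`. -/
def inducedUnit (p : P) : (inducedModule k c P).obj c := inducedTmul P (𝟙 (Free.of k c)) p

lemma map_inducedUnit (g : c ⟶ d) (p : P) :
    (inducedModule k c P).map g (inducedUnit P p) = inducedTmul P (LinHom.of k g) p :=
  congrArg (inducedTmul P · p) (Category.id_comp (LinHom.of k g))

lemma inducedUnit_add (p q : P) : inducedUnit P (p + q) = inducedUnit P p + inducedUnit P q :=
  BalTensor.tmul_add (R := EndAlg k c) (M := LinHom k c c) (𝟙 (Free.of k c)) p q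

lemma inducedUnit_zero : inducedUnit P 0 = 0 :=
  BalTensor.tmul_zero (R := EndAlg k c) (M := LinHom k c c) (𝟙 (Free.of k c))

/-- The `R_c`-linear map `p ↦ id ⊗ p`. -/
def inducedUnitLinear : P →ₗ[EndAlg k c] (inducedModule k c P).obj c where
  toFun := inducedUnit P
  map_add' := inducedUnit_add P
  map_smul' r p := by
    change inducedUnit P (r • p) = r • inducedUnit P p
    induction r using EndAlg.induction with
    | h0 => rw [zero_smul, zero_smul, inducedUnit_zero]
    | ha r s hr hs => rw [add_smul, add_smul, inducedUnit_add, hr, hs]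
    | hs a g =>
      have h : (a • EndAlg.of k g) • inducedUnit P p = inducedTmul P (a • LinHom.of k g) p := by
        rw [smul_assoc, endAlg_of_smul, map_inducedUnit, smul_inducedTmul]
      rw [h, inducedUnit, inducedTmul_smul]
      exact congrArg (inducedTmul P · p) (Category.comp_id (a • LinHom.of k g))

lemma inducedModule_tmul_induction {q : (inducedModule k c P).obj d → Prop} (h0 : q 0)
    (ha : ∀ x y, q x → q y → q (x + y)) (hq : ∀ f p, q (inducedTmul P f p))
    (x : (inducedModule k c P).obj d) : q x :=
  BalTensor.ind (R := EndAlg k c) (M := LinHom k c d) (P := P) (p := q) h0 hq ha x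

/-- The induced module is generated, additively and under morphisms of `C` alone, by the elements
`id ⊗ p`. -/
lemma inducedModule_induction {q : (inducedModule k c P).obj d → Prop} (h0 : q 0)
    (ha : ∀ x y, q x → q y → q (x + y))
    (hq : ∀ (g : c ⟶ d) (p : P), q ((inducedModule k c P).map g (inducedUnit P p)))
    (x : (inducedModule k c P).obj d) : q x := by
  refine inducedModule_tmul_induction P h0 ha (fun f p => ?_) x
  induction f using LinHom.induction with
  | h0 => rw [inducedTmul_zero]; exact h0
  | ha f g hf hg => rw [inducedTmul_add]; exact ha _ _ hf hg
  | hs a f =>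
    -- The scalar `a` is moved across the tensor sign and absorbed into `p`.
    have h := hq f ((a • 𝟙 (Free.of k c) : EndAlg k c) • p)
    rw [map_inducedUnit, inducedTmul_smul] at h
    have e : (a • 𝟙 (Free.of k c)) ≫ LinHom.of k f = a • LinHom.of k f := by
      rw [Linear.smul_comp, Category.id_comp]
    exact e ▸ h

variable {P} (M : C ⥤ ModuleCat.{u} k) (σ : P →ₗ[EndAlg k c] M.obj c)

/-- The additive map `f ⊗ p ↦ f (σ p)`. -/
def inducedDescAux (d : C) : (inducedModule k c P).obj d →+ M.obj d :=
  BalTensor.lift (R := EndAlg k c) (M := LinHom k c d) (P := P) (A := M.obj d)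
    (AddMonoidHom.mk' (fun f => (linAct M f).toAddMonoidHom.comp σ.toAddMonoidHom)
      fun f g => by
        ext p
        change linAct M (f + g) (σ p) = linAct M f (σ p) + linAct M g (σ p)
        rw [map_add]; rfl)
    (fun f r p => by
      change linAct M (r ≫ f) (σ p) = linAct M f (σ (r • p))
      rw [linAct_comp, map_smul]; rfl)

lemma inducedDescAux_tmul (f : LinHom k c d) (p : P) :
    inducedDescAux M σ d (inducedTmul P f p) = linAct M f (σ p) := rfl

/-- The `k`-linear map `f ⊗ p ↦ f (σ p)`. -/
def inducedDescLinear (d : C) : (inducedModule k c P).obj d →ₗ[k] M.obj d where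
  toFun := inducedDescAux M σ d
  map_add' := map_add _
  map_smul' a x := by
    induction x using inducedModule_tmul_induction with
    | h0 => simp
    | hq f p =>
      rw [smul_inducedTmul, inducedDescAux_tmul, inducedDescAux_tmul, map_smul]; rfl
    | ha x y hx hy => rw [smul_add, map_add, hx, hy, map_add, smul_add]

/-- An `R_c`-linear map `P → M(c)` induces a map `kC ⊗_{R_c} P ⟶ M`. -/
def inducedDesc : inducedModule k c P ⟶ M where
  app d := ModuleCat.ofHom (inducedDescLinear M σ d)
  naturality d e g := by
    apply ModuleCat.hom_ext
    apply LinearMap.ext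
    intro x
    change inducedDescAux M σ e ((inducedModule k c P).map g x) = M.map g (inducedDescAux M σ d x)
    induction x using inducedModule_tmul_induction with
    | h0 => simp
    | hq f p =>
      rw [inducedModule_map_tmul, inducedDescAux_tmul, inducedDescAux_tmul, ← linAct_of]
      exact linAct_comp M f (LinHom.of k g) (σ p)
    | ha x y hx hy => simp only [map_add, hx, hy]

lemma inducedDesc_unit (p : P) : (inducedDesc M σ).app c (inducedUnit P p) = σ p :=
  linAct_id M c (σ p)

end Induced

/-! ### Isomorphisms, the object order and representatives in an EI category. -/

section EILemmas

variable {C : Type u} [SmallCategory C]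

/-- The map `g ≫ inv (f ≫ g)` is a retraction of `f`; composed with `f` in the other order it is an
endomorphism of `y`, invertible by EI, which makes `f` split epi too. -/
lemma IsEI.isIso_of_isIso_comp (hEI : IsEI C) {x y z : C} (f : x ⟶ y) (g : y ⟶ z)
    (h : IsIso (f ≫ g)) : IsIso f ∧ IsIso g := by
  have he := hEI y (g ≫ inv (f ≫ g) ≫ f)
  have : IsSplitMono f := ⟨⟨g ≫ inv (f ≫ g), by rw [← Category.assoc, IsIso.hom_inv_id]⟩⟩
  have : IsSplitEpi f := ⟨⟨inv (g ≫ inv (f ≫ g) ≫ f) ≫ g ≫ inv (f ≫ g), by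
    simp only [Category.assoc, IsIso.inv_hom_id]⟩⟩
  have hf : IsIso f := isIso_of_mono_of_isSplitEpi f
  exact ⟨hf, IsIso.of_isIso_comp_left f g⟩

/-- An isomorphism `x ≅ y` would turn `f` into an endomorphism of `x`, hence make it invertible. -/
lemma IsEI.objLT_of_not_isIso (hEI : IsEI C) {x y : C} {f : x ⟶ y} (hf : ¬ IsIso f) :
    ObjLT x y :=
  ⟨⟨f⟩, fun ⟨e⟩ => hf (hEI.isIso_of_isIso_comp f e.inv (hEI x _)).1⟩

lemma ObjLT.trans_iso {x y z : C} (h : ObjLT x y) (e : y ≅ z) : ObjLT x z :=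
  ⟨h.1.map (· ≫ e.hom), fun ⟨i⟩ => h.2 ⟨i ≪≫ e.symm⟩⟩

lemma NoLeftInfiniteChains.wellFounded (h : NoLeftInfiniteChains C) :
    WellFounded (ObjLT : C → C → Prop) :=
  wellFounded_iff_isEmpty_descending_chain.2 ⟨fun f => h ⟨f.1, f.2⟩⟩

/-- A set of representatives of the isomorphism classes of objects. -/
structure IsSkeletal (T : Set C) : Prop where
  exists_iso : ∀ d : C, ∃ c ∈ T, Nonempty (c ≅ d)
  eq_of_iso : ∀ c ∈ T, ∀ d ∈ T, Nonempty (c ≅ d) → c = d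

variable (C) in
lemma exists_isSkeletal : ∃ T : Set C, IsSkeletal T := by
  refine ⟨Set.range fun q : Quotient (isIsomorphicSetoid C) => q.out, fun d => ?_, ?_⟩
  · exact ⟨_, ⟨Quotient.mk (isIsomorphicSetoid C) d, rfl⟩,
      Quotient.exact (Quotient.out_eq (Quotient.mk (isIsomorphicSetoid C) d))⟩
  · rintro _ ⟨q, rfl⟩ _ ⟨q', rfl⟩ h
    have : q = q' := by
      rw [← Quotient.out_eq q, ← Quotient.out_eq q']
      exact Quotient.sound h
    rw [this]

end EILemmas

/-! ### Extension by zero as right adjoint of the regular quotient. -/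

section ExtensionByZero

variable {k : Type u} [CommRing k] {C : Type u} [SmallCategory C]

variable (c : C) (B : Type u) [AddCommGroup B] [Module (EndAlg k c) B] [Module k B]
  [IsScalarTower k (EndAlg k c) B]

/-- The `G_c`-equivariant maps from the isomorphisms `d ≅ c` to `B`. -/
def equivariantMaps (d : C) : Submodule k ((d ≅ c) → B) where
  -- Equivariant functions avoid choosing an isomorphism `d ≅ c`: if one exists, evaluation at it
  -- identifies the space with `B`; if none exists, the domain is empty and the space is zero.
  carrier := {φ | ∀ (e : d ≅ c) (g : c ≅ c),
    φ (e ≪≫ g) = EndAlg.of k g.hom • φ e}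
  add_mem' hφ hψ e g := by simp only [Pi.add_apply, hφ e g, hψ e g, smul_add]
  zero_mem' e g := by simp
  smul_mem' a φ hφ e g := by
    have : SMulCommClass k (EndAlg k c) B := IsScalarTower.to_smulCommClass
    simp only [Pi.smul_apply, hφ e g]
    exact smul_comm _ _ _

open Classical in
/-- The functoriality of equivariant maps; non-isomorphisms act by zero. -/
def equivariantMapsMap {d d' : C} (f : d ⟶ d') :
    equivariantMaps (k := k) c B d →ₗ[k] equivariantMaps (k := k) c B d' where
  toFun φ := ⟨fun e => if h : IsIso f then φ.1 (asIso f ≪≫ e) else 0, fun e g => by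
    by_cases h : IsIso f
    · simp only [h, dite_true]
      rw [← φ.2, Iso.trans_assoc]
    · simp only [h, dite_false, smul_zero]⟩
  map_add' φ ψ := by
    ext e
    by_cases h : IsIso f <;> simp [h]
  map_smul' a φ := by
    ext e
    by_cases h : IsIso f <;> simp [h]

variable {c B}

lemma equivariantMapsMap_of_isIso {d d' : C} (f : d ⟶ d') [h : IsIso f]
    (φ : equivariantMaps (k := k) c B d) (e : d' ≅ c) :
    (equivariantMapsMap c B f φ).1 e = φ.1 (asIso f ≪≫ e) := dif_pos h

lemma equivariantMapsMap_of_not_isIso {d d' : C} (f : d ⟶ d') (h : ¬ IsIso f)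
    (φ : equivariantMaps (k := k) c B d) (e : d' ≅ c) :
    (equivariantMapsMap c B f φ).1 e = 0 := dif_neg h

variable (c B)

/-- The extension by zero of an `R_c`-module to a left `kC`-module. -/
def extendByZero (hEI : IsEI C) : C ⥤ ModuleCat.{u} k where
  obj d := ModuleCat.of k (equivariantMaps (k := k) c B d)
  map f := ModuleCat.ofHom (equivariantMapsMap c B f)
  map_id d := by
    apply ModuleCat.hom_ext
    refine LinearMap.ext fun φ => Subtype.ext (funext fun e => ?_)
    change (equivariantMapsMap c B (𝟙 d) φ).1 e = φ.1 e
    rw [equivariantMapsMap_of_isIso]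
    refine congrArg φ.1 (Iso.ext ?_)
    simp
  map_comp {d d' d''} f g := by
    apply ModuleCat.hom_ext
    refine LinearMap.ext fun φ => Subtype.ext (funext fun e => ?_)
    change (equivariantMapsMap c B (f ≫ g) φ).1 e =
      (equivariantMapsMap c B g (equivariantMapsMap c B f φ)).1 e
    -- Letting non-isomorphisms act by zero is functorial because, by EI, a composite is invertible
    -- only if both factors are.
    by_cases h : IsIso (f ≫ g)
    · obtain ⟨hf, hg⟩ := hEI.isIso_of_isIso_comp f g h
      simp only [equivariantMapsMap_of_isIso]
      refine congrArg φ.1 (Iso.ext ?_)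
      simp
    · rw [equivariantMapsMap_of_not_isIso _ h]
      by_cases hg : IsIso g
      · have hf : ¬ IsIso f := fun hf => h inferInstance
        rw [equivariantMapsMap_of_isIso, equivariantMapsMap_of_not_isIso _ hf]
      · rw [equivariantMapsMap_of_not_isIso _ hg]

variable {c B} {A : Type u} [AddCommGroup A] [Module (EndAlg k c) A] [Module k A]
  [IsScalarTower k (EndAlg k c) A]

/-- Functoriality of the equivariant maps in the module. -/
def equivariantMapsPostcomp (p : A →ₗ[EndAlg k c] B) (d : C) :
    equivariantMaps (k := k) c A d →ₗ[k] equivariantMaps (k := k) c B d where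
  toFun φ := ⟨fun e => p (φ.1 e), fun e g => by dsimp only; rw [φ.2, map_smul]⟩
  map_add' _ _ := Subtype.ext (funext fun _ => map_add p _ _)
  map_smul' a φ := Subtype.ext (funext fun e => LinearMap.map_smul_of_tower p a (φ.1 e))

/-- Functoriality of the extension by zero. -/
def extendByZeroMap (hEI : IsEI C) (p : A →ₗ[EndAlg k c] B) :
    extendByZero c A hEI ⟶ extendByZero (k := k) c B hEI where
  app d := ModuleCat.ofHom (equivariantMapsPostcomp p d)
  naturality d d' f := by
    apply ModuleCat.hom_ext
    refine LinearMap.ext fun (φ : equivariantMaps (k := k) c A d) =>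
      Subtype.ext (funext fun e => ?_)
    change p ((equivariantMapsMap c A f φ).1 e) =
      (equivariantMapsMap c B f (equivariantMapsPostcomp p d φ)).1 e
    by_cases hf : IsIso f
    · rw [equivariantMapsMap_of_isIso, equivariantMapsMap_of_isIso]
      rfl
    · rw [equivariantMapsMap_of_not_isIso _ hf, equivariantMapsMap_of_not_isIso _ hf, map_zero]

/-- Objectwise the map is a copy of `p` or a map between zero modules. -/
lemma epi_extendByZeroMap (hEI : IsEI C) (p : A →ₗ[EndAlg k c] B) (hp : Function.Surjective p) :
    Epi (extendByZeroMap hEI p) := by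
  have : ∀ d, Epi ((extendByZeroMap hEI p).app d) := by
    intro d
    rw [ModuleCat.epi_iff_surjective]
    intro (φ : equivariantMaps (k := k) c B d)
    by_cases h : Nonempty (d ≅ c)
    · obtain ⟨e₀⟩ := h
      obtain ⟨a, ha⟩ := hp (φ.1 e₀)
      -- The unique equivariant function with value `a` at `e₀`.
      refine ⟨(⟨fun e => EndAlg.of k (e₀.inv ≫ e.hom) • a, fun e g => ?_⟩ :
        equivariantMaps (k := k) c A d), Subtype.ext (funext fun e => ?_)⟩
      · dsimp only
        rw [Iso.trans_hom, ← Category.assoc, EndAlg.of_comp, mul_smul]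
      · change p (EndAlg.of k (e₀.inv ≫ e.hom) • a) = φ.1 e
        rw [map_smul, ha]
        refine (φ.2 e₀ (e₀.symm ≪≫ e)).symm.trans ?_
        refine congrArg φ.1 (Iso.ext ?_)
        simp
    · refine ⟨(0 : equivariantMaps (k := k) c A d), Subtype.ext (funext fun e => ?_)⟩
      exact (h ⟨e⟩).elim
  exact NatTrans.epi_of_epi_app _

/-- The `k`-linear map `M(d) → equivariantMaps c B d` induced by an `R_c`-linear `h : M(c) → B`. -/
def toEquivariantMaps (M : C ⥤ ModuleCat.{u} k) (h : M.obj c →ₗ[EndAlg k c] B) (d : C) :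
    M.obj d →ₗ[k] equivariantMaps (k := k) c B d where
  toFun m := ⟨fun e => h (M.map e.hom m), fun e g => by
    dsimp only
    rw [Iso.trans_hom, M.map_comp, ModuleCat.comp_apply, ← endAlg_of_smul M g.hom, map_smul]⟩
  map_add' m m' := Subtype.ext (funext fun e => by
    change h (M.map e.hom (m + m')) = h (M.map e.hom m) + h (M.map e.hom m')
    rw [map_add, map_add])
  map_smul' a m := Subtype.ext (funext fun e => by
    change h (M.map e.hom (a • m)) = a • h (M.map e.hom m)
    rw [map_smul, LinearMap.map_smul_of_tower])

/-- An `R_c`-linear map `M(c) → B` that kills the images of the non-isomorphisms induces a map from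
`M` to the extension by zero of `B`. -/
def extendByZeroLift (hEI : IsEI C) (M : C ⥤ ModuleCat.{u} k) (h : M.obj c →ₗ[EndAlg k c] B)
    (h0 : ∀ (d : C) (f : d ⟶ c) (m : M.obj d), ¬ IsIso f → h (M.map f m) = 0) :
    M ⟶ extendByZero (k := k) c B hEI where
  app d := ModuleCat.ofHom (toEquivariantMaps M h d)
  naturality d d' f := by
    apply ModuleCat.hom_ext
    refine LinearMap.ext fun m => Subtype.ext (funext fun e => ?_)
    change h (M.map e.hom (M.map f m)) =
      (equivariantMapsMap c B f (toEquivariantMaps M h d m)).1 e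
    rw [← ModuleCat.comp_apply, ← M.map_comp]
    by_cases hf : IsIso f
    · rw [equivariantMapsMap_of_isIso]
      rfl
    · rw [equivariantMapsMap_of_not_isIso _ hf]
      exact h0 _ _ _ fun hfe => hf (hEI.isIso_of_isIso_comp f e.hom hfe).1

/-- The value at the identity of `c` of the components of a map to an extension by zero. -/
def extendByZeroEval {hEI : IsEI C} {M : C ⥤ ModuleCat.{u} k} (t : M ⟶ extendByZero c B hEI) :
    M.obj c →ₗ[k] B where
  toFun m := (show equivariantMaps (k := k) c B c from t.app c m).1 (Iso.refl c)
  map_add' m m' := by rw [map_add]; rfl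
  map_smul' a m := by rw [map_smul]; rfl

/-- By this vanishing the transpose of `t` descends to the regular quotient of `M(c)`. -/
lemma extendByZeroEval_map_of_not_isIso {hEI : IsEI C} {M : C ⥤ ModuleCat.{u} k}
    (t : M ⟶ extendByZero c B hEI) {d : C} (f : d ⟶ c) (hf : ¬ IsIso f) (m : M.obj d) :
    extendByZeroEval t (M.map f m) = 0 := by
  have h : t.app c (M.map f m) = equivariantMapsMap c B f (t.app d m) :=
    NatTrans.naturality_apply t f m
  refine Eq.trans ?_ (equivariantMapsMap_of_not_isIso f hf (t.app d m) (Iso.refl c))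
  exact congrArg (fun φ : equivariantMaps (k := k) c B c => φ.1 (Iso.refl c)) h

lemma extendByZeroEval_map {hEI : IsEI C} {M : C ⥤ ModuleCat.{u} k}
    (t : M ⟶ extendByZero c B hEI) (g : c ⟶ c) (m : M.obj c) :
    extendByZeroEval t (M.map g m) = EndAlg.of k g • extendByZeroEval t m := by
  have := hEI c g
  have h : t.app c (M.map g m) = equivariantMapsMap c B g (t.app c m) :=
    NatTrans.naturality_apply t g m
  let φ : equivariantMaps (k := k) c B c := t.app c m
  refine (congrArg (fun φ : equivariantMaps (k := k) c B c => φ.1 (Iso.refl c)) h).trans ?_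
  refine (equivariantMapsMap_of_isIso g φ (Iso.refl c)).trans ?_
  refine Eq.trans ?_ (φ.2 (Iso.refl c) (asIso g))
  rw [Iso.trans_refl, Iso.refl_trans]

/-- `extendByZeroEval` is `R_c`-linear. -/
def extendByZeroTranspose {hEI : IsEI C} {M : C ⥤ ModuleCat.{u} k}
    (t : M ⟶ extendByZero c B hEI) : M.obj c →ₗ[EndAlg k c] B where
  toFun := extendByZeroEval t
  map_add' := map_add _
  map_smul' r m := by
    change extendByZeroEval t (r • m) = r • extendByZeroEval t m
    induction r using EndAlg.induction with
    | h0 => rw [zero_smul, zero_smul, map_zero]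
    | ha r s hr hs => rw [add_smul, add_smul, map_add, hr, hs]
    | hs a g => rw [smul_assoc, smul_assoc, map_smul, endAlg_of_smul, extendByZeroEval_map]

end ExtensionByZero

/-! ### Singular parts and projectivity of the regular quotients. -/

section SingularPart

variable {k : Type u} [CommRing k] {C : Type u} [SmallCategory C] (T : Set C)

/-- The `R_c`-submodule of `M(c)` generated by the images of the non-isomorphisms if `c ∈ T`, and
all of `M(c)` otherwise. -/
def singularPart (M : C ⥤ ModuleCat.{u} k) (c : C) : Submodule (EndAlg k c) (M.obj c) :=
  -- For `c ∉ T` the condition on `f` is void, so `f = 𝟙 c` is allowed and the span is everything.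
  Submodule.span _ {x | ∃ (d : C) (f : d ⟶ c) (m : M.obj d), ¬ (IsIso f ∧ c ∈ T) ∧ M.map f m = x}

variable {T}

lemma map_mem_singularPart (M : C ⥤ ModuleCat.{u} k) {c d : C} (f : d ⟶ c) (hf : ¬ IsIso f)
    (m : M.obj d) : M.map f m ∈ singularPart T M c :=
  Submodule.subset_span ⟨d, f, m, fun h => hf h.1, rfl⟩

lemma singularPart_eq_top (M : C ⥤ ModuleCat.{u} k) {c : C} (hc : c ∉ T) :
    singularPart T M c = ⊤ :=
  eq_top_iff.2 fun m _ => Submodule.subset_span ⟨c, 𝟙 c, m, fun h => hc h.2, by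
    rw [M.map_id]; rfl⟩

lemma singularPart_le {M : C ⥤ ModuleCat.{u} k} {c : C} (hc : c ∈ T)
    {V : Submodule (EndAlg k c) (M.obj c)}
    (hV : ∀ (d : C) (f : d ⟶ c) (m : M.obj d), ¬ IsIso f → M.map f m ∈ V) :
    singularPart T M c ≤ V := by
  refine Submodule.span_le.2 ?_
  rintro _ ⟨d, f, m, hf, rfl⟩
  exact hV d f m fun h => hf ⟨h, hc⟩

lemma appEnd_mem_singularPart {M M' : C ⥤ ModuleCat.{u} k} (φ : M ⟶ M') {c : C} {x : M.obj c}
    (hx : x ∈ singularPart T M c) : appEnd φ c x ∈ singularPart T M' c := by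
  suffices h : singularPart T M c ≤ (singularPart T M' c).comap (appEnd φ c) from h hx
  refine Submodule.span_le.2 ?_
  rintro _ ⟨d, f, m, hf, rfl⟩
  exact Submodule.subset_span ⟨d, f, φ.app d m, hf, (NatTrans.naturality_apply φ f m).symm⟩

/-- A left adjoint whose right adjoint preserves epimorphisms preserves projectives. For `c ∉ T` the
quotient is zero. -/
lemma projective_quotient_singularPart (hEI : IsEI C) (M : C ⥤ ModuleCat.{u} k)
    (hM : Projective M) (c : C) :
    Module.Projective (EndAlg k c) (M.obj c ⧸ singularPart T M c) := by
  by_cases hc : c ∈ T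
  · refine Module.Projective.of_lifting_property'' fun p hp => ?_
    have := epi_extendByZeroMap hEI p hp
    -- The unit of the adjunction. Its lift `t` through the extension of `p` transposes to the
    -- section of `p`.
    let u : M ⟶ extendByZero (k := k) c (M.obj c ⧸ singularPart T M c) hEI :=
      extendByZeroLift hEI M (singularPart T M c).mkQ fun d f m hf =>
        (Submodule.Quotient.mk_eq_zero _).2 (map_mem_singularPart M f hf m)
    let t := Projective.factorThru u (extendByZeroMap hEI p)
    have ht : t ≫ extendByZeroMap hEI p = u := Projective.factorThru_comp _ _
    have hker : singularPart T M c ≤ LinearMap.ker (extendByZeroTranspose t) :=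
      singularPart_le hc fun d f m hf => extendByZeroEval_map_of_not_isIso t f hf m
    refine ⟨(singularPart T M c).liftQ _ hker,
      Submodule.linearMap_qext _ (LinearMap.ext fun m => ?_)⟩
    change p (extendByZeroEval t m) = (singularPart T M c).mkQ m
    have e : extendByZeroEval (t ≫ extendByZeroMap hEI p) m = extendByZeroEval u m := by rw [ht]
    refine Eq.trans e ?_
    change (singularPart T M c).mkQ (M.map (𝟙 c) m) = _
    rw [M.map_id]; rfl
  · have : Subsingleton (M.obj c ⧸ singularPart T M c) :=
      Submodule.Quotient.subsingleton_iff.2 (singularPart_eq_top M hc)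
    exact Module.Projective.of_free

end SingularPart

/-! ### The Nakayama argument and the decomposition. -/

section Splitting

variable {k : Type u} [CommRing k] {C : Type u} [SmallCategory C] {T : Set C}

/-- Nakayama's lemma, with well-foundedness of the object order in place of nilpotence: the singular
part comes from strictly smaller objects, where surjectivity is already known. -/
lemma IsSkeletal.surjective_app (hT : IsSkeletal T) (hEI : IsEI C)
    (hchain : NoLeftInfiniteChains C) {M M' : C ⥤ ModuleCat.{u} k} (ψ : M ⟶ M')
    (hψ : ∀ c ∈ T, ∀ x : M'.obj c, ∃ y : M.obj c, x - ψ.app c y ∈ singularPart T M' c) (d : C) :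
    Function.Surjective (ψ.app d) := by
  induction d using hchain.wellFounded.induction with
  | _ d ih =>
  obtain ⟨c, hc, ⟨e⟩⟩ := hT.exists_iso d
  have hsing : singularPart T M' c ≤ LinearMap.range (appEnd ψ c) := by
    refine singularPart_le hc fun d' f m hf => ?_
    obtain ⟨y, rfl⟩ := ih d' ((hEI.objLT_of_not_isIso hf).trans_iso e) m
    exact ⟨M.map f y, NatTrans.naturality_apply ψ f y⟩
  intro x
  obtain ⟨y, hy⟩ := hψ c hc (M'.map e.inv x)
  obtain ⟨z, hz⟩ := hsing hy
  refine ⟨M.map e.hom (z + y), ?_⟩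
  have h : ψ.app c (z + y) = M'.map e.inv x := by
    rw [map_add]
    exact eq_sub_iff_add_eq.1 hz
  rw [NatTrans.naturality_apply ψ e.hom, h, ← ModuleCat.comp_apply, ← M'.map_comp, e.inv_hom_id,
    M'.map_id]
  rfl

lemma epi_of_surjective_app {M M' : C ⥤ ModuleCat.{u} k} (ψ : M ⟶ M')
    (h : ∀ d, Function.Surjective (ψ.app d)) : Epi ψ := by
  have : ∀ d, Epi (ψ.app d) := fun d => (ModuleCat.epi_iff_surjective _).2 (h d)
  exact NatTrans.epi_of_epi_app _

/-- Evaluation at `d` preserves coproducts, so the quotient map by `V` vanishes once it vanishes on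
every summand. -/
lemma sigma_obj_eq_top (X : C → C ⥤ ModuleCat.{u} k) (d : C) (V : Submodule k ((∐ X).obj d))
    (hV : ∀ c (x : (X c).obj d), (Sigma.ι X c).app d x ∈ V) : V = ⊤ := by
  have h : ModuleCat.ofHom V.mkQ = (0 : (∐ X).obj d ⟶ ModuleCat.of k ((∐ X).obj d ⧸ V)) := by
    refine (isColimitOfPreserves ((evaluation C (ModuleCat.{u} k)).obj d)
      (colimit.isColimit (Discrete.functor X))).hom_ext fun ⟨c⟩ => ?_
    apply ModuleCat.hom_ext
    refine LinearMap.ext fun x => ?_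
    exact (Submodule.Quotient.mk_eq_zero V).2 (hV c x)
  rw [← V.ker_mkQ, show V.mkQ = 0 from congrArg ModuleCat.Hom.hom h, LinearMap.ker_zero]

/-- The quotient of `M(c)` by its singular part. -/
abbrev regularQuotient (T : Set C) (M : C ⥤ ModuleCat.{u} k) (c : C) : ModuleCat.{u} (EndAlg k c) :=
  ModuleCat.of _ (M.obj c ⧸ singularPart T M c)

lemma subsingleton_regularQuotient (M : C ⥤ ModuleCat.{u} k) {c : C} (hc : c ∉ T) :
    Subsingleton (regularQuotient T M c) :=
  Submodule.Quotient.subsingleton_iff.2 (singularPart_eq_top M hc)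

/-- The sum of the modules induced from a family of modules over the endomorphism rings. -/
abbrev inducedSum (P : (c : C) → ModuleCat.{u} (EndAlg k c)) : C ⥤ ModuleCat.{u} k :=
  ∐ fun c => inducedModule k c (P c)

/-- The map `p ↦ id ⊗ p` to the summand of index `c`. -/
def inducedSumUnit (P : (c : C) → ModuleCat.{u} (EndAlg k c)) (c : C) :
    P c →ₗ[EndAlg k c] (inducedSum P).obj c :=
  (appEnd (Sigma.ι (fun c => inducedModule k c (P c)) c) c).comp (inducedUnitLinear (P c))

lemma inducedSum_obj_eq_top (P : (c : C) → ModuleCat.{u} (EndAlg k c)) (d : C)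
    (V : Submodule k ((inducedSum P).obj d))
    (hV : ∀ c (g : c ⟶ d) (p : P c), (inducedSum P).map g (inducedSumUnit P c p) ∈ V) : V = ⊤ := by
  refine sigma_obj_eq_top _ d V fun c x => ?_
  induction x using inducedModule_induction with
  | h0 => rw [map_zero]; exact V.zero_mem
  | ha x y hx hy => rw [map_add]; exact V.add_mem hx hy
  | hq g p =>
    rw [NatTrans.naturality_apply]
    exact hV c g p

/-- On a generator `g (id ⊗ p)`, either `g` is not invertible and the element is singular, or `g`
lies in `G_c` because its source is in `T`, or `p = 0` because its source is not. -/
lemma IsSkeletal.range_unit_sup_singularPart (hT : IsSkeletal T)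
    (P : (c : C) → ModuleCat.{u} (EndAlg k c)) (hP : ∀ c ∉ T, Subsingleton (P c)) {c : C}
    (hc : c ∈ T) :
    LinearMap.range (inducedSumUnit P c) ⊔ singularPart T (inducedSum P) c = ⊤ := by
  rw [← Submodule.restrictScalars_eq_top_iff k]
  refine inducedSum_obj_eq_top P c _ fun c' g p => ?_
  rw [Submodule.restrictScalars_mem]
  by_cases hg : IsIso g
  · by_cases hc' : c' ∈ T
    · obtain rfl := hT.eq_of_iso c' hc' c hc ⟨asIso g⟩
      rw [← endAlg_of_smul, ← map_smul]
      exact Submodule.mem_sup_left ⟨_, rfl⟩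
    · have := hP c' hc'
      rw [Subsingleton.elim p 0, map_zero, map_zero]
      exact Submodule.zero_mem _
  · exact Submodule.mem_sup_right (map_mem_singularPart _ g hg _)

/-- The map `⨁ kC ⊗_{R_c} P_c ⟶ M` induced by maps `P_c → M(c)`. -/
def inducedSumDesc {P : (c : C) → ModuleCat.{u} (EndAlg k c)} (M : C ⥤ ModuleCat.{u} k)
    (σ : (c : C) → P c →ₗ[EndAlg k c] M.obj c) : inducedSum P ⟶ M :=
  Sigma.desc fun c => inducedDesc M (σ c)

lemma inducedSumDesc_unit {P : (c : C) → ModuleCat.{u} (EndAlg k c)} (M : C ⥤ ModuleCat.{u} k)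
    (σ : (c : C) → P c →ₗ[EndAlg k c] M.obj c) (c : C) (p : P c) :
    (inducedSumDesc M σ).app c (inducedSumUnit P c p) = σ c p := by
  have h : Sigma.ι (fun c => inducedModule k c (P c)) c ≫ inducedSumDesc M σ =
      inducedDesc M (σ c) := Sigma.ι_desc _ _
  rw [← inducedDesc_unit M (σ c) p, ← h]
  rfl

/-- Over an EI category without left-infinite chains of objects, a projective module is the sum of
the modules induced from the quotients of its values by their singular parts. -/
theorem IsSkeletal.nonempty_iso_inducedSum (hT : IsSkeletal T) (hEI : IsEI C)
    (hchain : NoLeftInfiniteChains C) (M : C ⥤ ModuleCat.{u} k) (hM : Projective M) :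
    Nonempty (M ≅ inducedSum (regularQuotient T M)) := by
  have hproj := fun c => projective_quotient_singularPart (T := T) hEI M hM c
  choose σ hσ using fun c => Module.projective_lifting_property (singularPart T M c).mkQ
    (LinearMap.id : _ →ₗ[EndAlg k c] _) (Submodule.mkQ_surjective _)
  have hσ' : ∀ c x, (singularPart T M c).mkQ (σ c x) = x := fun c x => LinearMap.congr_fun (hσ c) x
  let φ : inducedSum (regularQuotient T M) ⟶ M := inducedSumDesc M σ
  have hφ : Epi φ := epi_of_surjective_app φ <| hT.surjective_app hEI hchain φ fun c _ x => by
    refine ⟨inducedSumUnit (regularQuotient T M) c ((singularPart T M c).mkQ x), ?_⟩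
    rw [inducedSumDesc_unit, ← Submodule.Quotient.mk_eq_zero]
    change (singularPart T M c).mkQ _ = 0
    rw [map_sub, hσ', sub_self]
  -- Write `z = id ⊗ p + w` with `w` singular. Modulo the singular part, `φ z` is the class `p`, so
  -- `φ z = 0` forces `p = 0`.
  have hker : ∀ c ∈ T, ∀ z : (inducedSum (regularQuotient T M)).obj c, φ.app c z = 0 →
      z ∈ singularPart T (inducedSum (regularQuotient T M)) c := by
    intro c hc z hz
    have hz' : z ∈ LinearMap.range (inducedSumUnit (regularQuotient T M) c) ⊔
        singularPart T (inducedSum (regularQuotient T M)) c := by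
      rw [hT.range_unit_sup_singularPart _ (fun c hc => subsingleton_regularQuotient M hc) hc]
      trivial
    obtain ⟨_, ⟨p, rfl⟩, w, hw, rfl⟩ := Submodule.mem_sup.1 hz'
    have hp : p = 0 := by
      rw [map_add, inducedSumDesc_unit] at hz
      have h := congrArg (singularPart T M c).mkQ hz
      rw [map_add, hσ', map_zero] at h
      have h' : (singularPart T M c).mkQ (φ.app c w) = 0 :=
        (Submodule.Quotient.mk_eq_zero _).2 (appEnd_mem_singularPart φ hw)
      rw [h', add_zero] at h
      exact h
    rw [hp, map_zero, zero_add]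
    exact hw
  let s : M ⟶ inducedSum (regularQuotient T M) := Projective.factorThru (𝟙 M) φ
  have hs : s ≫ φ = 𝟙 M := Projective.factorThru_comp _ _
  have : IsSplitMono s := ⟨⟨φ, hs⟩⟩
  -- The element `x - s (φ x)` lies in `ker φ`, hence in the singular part.
  have : Epi s := epi_of_surjective_app s <| hT.surjective_app hEI hchain s fun c hc x => by
    refine ⟨φ.app c x, hker c hc _ ?_⟩
    have h : φ.app c (s.app c (φ.app c x)) = φ.app c x := by
      change (s ≫ φ).app c (φ.app c x) = φ.app c x
      rw [hs]; rfl
    rw [map_sub, h, sub_self]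
  have : IsIso s := isIso_of_epi_of_isSplitMono s
  exact ⟨asIso s⟩

end Splitting

end

theorem theoremB (N : ℕ) (hN : 1 ≤ N) (k : Type u) [CommRing k] (C : Type u) [SmallCategory C]
    (hEI : IsEI C) (hFFP : FFP C) (hUFP : UFP C)
    (hgl : ∀ c : C, GlobalDimensionLE (EndAlg k c) N)
    (hA : ConditionA k C N) (hB : ConditionB k C N) (hBP : ConditionBP k C)
    (hchain : NoLeftInfiniteChains C)
    (M : C ⥤ ModuleCat.{u} k) (hM : Projective M) :
    ∃ P : (c : C) → ModuleCat.{u} (EndAlg k c),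
      (∀ c, Projective (P c)) ∧ Nonempty (M ≅ ∐ fun c : C => inducedModule k c (P c)) := by
  obtain ⟨T, hT⟩ := exists_isSkeletal C
  refine ⟨regularQuotient T M, fun c => ?_, hT.nonempty_iso_inducedSum hEI hchain M hM⟩
  exact (IsProjective.iff_projective _).1 (projective_quotient_singularPart hEI M hM c)
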